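/- For a $d$-regular (simple, undirected) graph $G$ on the vertex set $[n]$ with $d\ge 1$, write $G$ also for its random walk matrix ($G_{ij}=1/d$ if $i\sim j$ and $G_{ij}=0$ otherwise). For nonempty $S\subseteq[n]$ with indicator vector $\mathbf 1_S\in\{0,1\}^n$ let $\Phi_G(S)=1-\frac{1}{|S|}\langle \mathbf 1_S,G\mathbf 1_S\rangle$, and for $\delta>0$ let $\Phi_G^{\le}(\delta)=\inf\{\Phi_G(S): S\neq\emptyset,\ |S|\le\delta n\}$. Let $\Pi_{1/2}$ be the matrix of the orthogonal projection of $\mathbb R^n$ onto the span of the eigenvectors of $G$ with eigenvalue at least $1/2$. An isotropic spectral embedding of $G$ is a family $b_1,\dots,b_n$ of vectors $b_i=\sqrt n\,a_i$, where $a_1,\dots,a_n$ are the rows of a real matrix $A$ with $AA^{\top}=\Pi_{1/2}$. There are universal constants $\varepsilon_0,C,C'>0$ such that the following holds. Let $G$ be a $d$-regular graph on $[n]$ with $d\ge1$, let $0<\varepsilon<\varepsilon_0$, and let $\delta$ be a real number with $\delta n\ge 2$ such that $\Phi_G^{\le}(\delta)\ge 1-\varepsilon$. Let $b_1,\dots,b_n$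 be an isotropic spectral embedding of $G$. Then for every nonempty $T\subseteq[n]$ with $|T|\le\delta n$, $$\Big\|\frac1{|T|}\sum_{i\in T}b_i\Big\|\le C'\exp\Big(C\cdot\frac{\log(\delta n/|T|)}{\log(1/\varepsilon)}\Big)\cdot\frac{\varepsilon^{1/10}}{\sqrt\delta},$$ where $\|\cdot\|$ is the Euclidean norm. -/

import Mathlib

open scoped Finset Matrix

noncomputable section

namespace SpectralEmbedding

section Graph

variable {V : Type*} [Fintype V] [DecidableEq V] (G : SimpleGraph V) [DecidableRel G.Adj]

/-- The random walk matrix of `G`: the entry at `(i, j)` is the probability that one step of the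
walk leads from `i` to `j`. -/
def walkMatrix : Matrix V V ℝ :=
  Matrix.of fun i j => if G.Adj i j then (G.degree i : ℝ)⁻¹ else 0

/-- The 0/1 indicator vector of a vertex set. -/
def indicatorVec (S : Finset V) : V → ℝ := fun i => if i ∈ S then 1 else 0

/-- The expansion `Φ_G(S) = 1 - ⟨1_S, G 1_S⟩ / |S|` of a (nonempty) vertex set `S`. -/
def expansion (S : Finset V) : ℝ :=
  1 - (1 / (#S : ℝ)) * (indicatorVec S ⬝ᵥ (walkMatrix G *ᵥ indicatorVec S))

/-- The expansion profile `Φ_G^≤(δ)`: the infimum of `Φ_G(S)` over all nonempty vertex sets `S`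
with `|S| ≤ δ n`, where `n` is the number of vertices. -/
def expansionProfileLE (δ : ℝ) : ℝ :=
  sInf {x : ℝ | ∃ S : Finset V, S.Nonempty ∧ (#S : ℝ) ≤ δ * (Fintype.card V : ℝ) ∧
    x = expansion G S}

/-- The span of the eigenvectors of the random walk matrix with eigenvalue at least `1/2`. -/
def highEigenspace : Submodule ℝ (EuclideanSpace ℝ V) :=
  Submodule.span ℝ {v | ∃ μ : ℝ, 1 / 2 ≤ μ ∧
    Module.End.HasEigenvector (Matrix.toEuclideanLin (walkMatrix G)) μ v}

/-- The matrix `Π_{1/2}` of the orthogonal projection onto `highEigenspace G`. -/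
def highProjection : Matrix V V ℝ :=
  (Matrix.toEuclideanCLM (n := V) (𝕜 := ℝ)).symm (highEigenspace G).starProjection

/-- `b` is an isotropic spectral embedding of `G`: there is a matrix `A` with `A Aᵀ = Π_{1/2}` such
that `b i` is `√n` times the `i`-th row of `A`. No further normalization of `A` (such as its first
column being `1/√n` times the all-ones vector) is imposed, so that every choice of `A` is
covered. -/
def IsIsotropicSpectralEmbedding {r : ℕ} (b : V → EuclideanSpace ℝ (Fin r)) : Prop :=
  ∃ A : Matrix V (Fin r) ℝ, A * Aᵀ = highProjection G ∧
    ∀ i, b i = Real.sqrt (Fintype.card V : ℝ) • WithLp.toLp 2 (A i)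

end Graph

end SpectralEmbedding

end

noncomputable section

namespace SpectralEmbedding

/-! ### Weights compared with indicators of sets -/

section Combinatorics

variable {V : Type*} [DecidableEq V]

/-! Since `A Aᵀ` is the projection `Π`, a combination `∑ x i • b i` has norm `√n ‖Π x‖`. On the
range of `Π` the walk shrinks norms by at most a factor 2, so `1_T` may be replaced by `g = G 1_T`
(`norm_sum_le_two_mul`). Small-set expansion makes `g` spread out: its mass at points above `θ` is
`O(ε |T| / θ)`.

Put `k = δn`, `η = ε^(3/10)`, `a = 20 / log(1/ε)`, and let `M` be the largest ratio `‖∑_T b i‖ /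
|T|^(1-a)` over nonempty sets of size at most `k`. If the maximizer has size `t ≤ ηk`, split `g` at
height `η`. The low part acts like `η` times a set of size `t/η` and costs `O(η^a)`; the high part
acts like a set of size `O(εt/η)` and costs `O((ε/η)^(1-a))`. Together this is below 1/2, so `M = 0`
(`norm_sum_le_of_forall_le`). If the maximizer is larger than `ηk`, the `ℓ²` bound `norm_sum_sq_le`
suffices, as `ε^(1/4) η^(-1/2) = ε^(1/10)`. -/

/-- An affine bound on the sums of `F` over small sets extends to all sets, at the price of one
constant term for every `m` elements. -/
theorem sum_le_of_forall_card_le {F : V → ℝ} {α β : ℝ} {m : ℕ} (hm : 0 < m) (hβ : 0 ≤ β)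
    (h : ∀ S : Finset V, #S ≤ m → ∑ i ∈ S, F i ≤ α * #S + β) (S : Finset V) :
    ∑ i ∈ S, F i ≤ α * #S + β * (#S / m + 1) := by
  have hm' : (0 : ℝ) < m := by exact_mod_cast hm
  induction S using Finset.strongInduction with
  | H S ih =>
    by_cases hS : #S ≤ m
    · have h1 := h S hS
      have h2 : 0 ≤ β * (#S / m : ℝ) := by positivity
      linarith
    · obtain ⟨U, hUS, hU⟩ := Finset.exists_subset_card_eq (le_of_not_ge hS)
      have hne : U.Nonempty := Finset.card_pos.mp (hU ▸ hm)
      have h1 := ih (S \ U) (Finset.sdiff_ssubset hUS hne)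
      have h2 := h U hU.le
      have h3 : ((#(S \ U) : ℕ) : ℝ) = #S - m := by
        rw [Finset.cast_card_sdiff hUS, hU]
      rw [h3] at h1
      rw [hU] at h2
      rw [← Finset.sum_sdiff hUS]
      have h4 : ((#S : ℝ) - m) / m = #S / m - 1 := by field_simp
      rw [h4] at h1
      linarith

variable [Fintype V]

/-- If all sums of `v` over sets of at most `m` elements are at most `L`, then pairing `v` with a
weight that is bounded by `c` and has mass `s` gives at most `(c + s / m) L`. -/
theorem sum_mul_le_of_forall_card_le {v h : V → ℝ} {c s L : ℝ} {m : ℕ} (hm : 0 < m)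
    (hv : ∀ S : Finset V, #S ≤ m → ∑ i ∈ S, v i ≤ L)
    (h0 : ∀ i, 0 ≤ h i) (hc : ∀ i, h i ≤ c) (hs : ∑ i, h i ≤ s) (hc0 : 0 ≤ c) :
    ∑ i, h i * v i ≤ (c + s / m) * L := by
  have hm' : (0 : ℝ) < m := by exact_mod_cast hm
  have hL : 0 ≤ L := by simpa using hv ∅ (by simp)
  -- Exchange argument on a maximizing `S`: deleting a point shows `v ≥ 0` on `S`; adding a point,
  -- or swapping it for a below-average one when `S` is full, shows `v ≤ L / m` off `S`.
  obtain ⟨S, hS, hmax⟩ := Finset.exists_max_image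
    (Finset.univ.filter fun S : Finset V => #S ≤ m) (fun S => ∑ i ∈ S, v i) ⟨∅, by simp⟩
  simp only [Finset.mem_filter, Finset.mem_univ, true_and] at hS hmax
  have hin : ∀ i ∈ S, 0 ≤ v i := by
    intro i hi
    have h1 := hmax (S.erase i) ((Finset.card_erase_le).trans hS)
    have h2 := Finset.add_sum_erase S v hi
    linarith
  have hout : ∀ i, i ∉ S → v i ≤ L / m := by
    intro i hi
    rcases hS.lt_or_eq with hlt | heq
    · have h1 := hmax (insert i S) (by rw [Finset.card_insert_of_notMem hi]; omega)
      rw [Finset.sum_insert hi] at h1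
      have : 0 ≤ L / m := by positivity
      linarith
    · obtain ⟨j, hj, hjv⟩ : ∃ j ∈ S, v j ≤ L / m := by
        apply Finset.exists_le_of_sum_le (Finset.card_pos.mp (heq ▸ hm))
        rw [Finset.sum_const, heq, nsmul_eq_mul, mul_div_cancel₀ _ hm'.ne']
        exact hv S hS
      have hi' : i ∉ S.erase j := fun hh => hi (Finset.mem_of_mem_erase hh)
      have h1 := hmax (insert i (S.erase j)) (by
        rw [Finset.card_insert_of_notMem hi', Finset.card_erase_of_mem hj]; omega)
      rw [Finset.sum_insert hi'] at h1
      have h2 := Finset.add_sum_erase S v hj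
      linarith
  rw [← Finset.sum_add_sum_compl S]
  have h1 : ∑ i ∈ S, h i * v i ≤ c * L := by
    calc ∑ i ∈ S, h i * v i ≤ ∑ i ∈ S, c * v i :=
          Finset.sum_le_sum fun i hi => mul_le_mul_of_nonneg_right (hc i) (hin i hi)
      _ = c * ∑ i ∈ S, v i := by rw [Finset.mul_sum]
      _ ≤ c * L := mul_le_mul_of_nonneg_left (hv S hS) hc0
  have h2 : ∑ i ∈ Sᶜ, h i * v i ≤ s * (L / m) := by
    calc ∑ i ∈ Sᶜ, h i * v i ≤ ∑ i ∈ Sᶜ, h i * (L / m) :=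
          Finset.sum_le_sum fun i hi =>
            mul_le_mul_of_nonneg_left (hout i (Finset.mem_compl.mp hi)) (h0 i)
      _ = (∑ i ∈ Sᶜ, h i) * (L / m) := by rw [Finset.sum_mul]
      _ ≤ s * (L / m) := by
          refine mul_le_mul_of_nonneg_right (le_trans ?_ hs) (by positivity)
          exact Finset.sum_le_univ_sum_of_nonneg h0
  calc _ ≤ c * L + s * (L / m) := add_le_add h1 h2
    _ = _ := by ring

/-- The vector-valued form of `sum_mul_le_of_forall_card_le`. -/
theorem norm_sum_smul_le_of_forall_card_le {E : Type*} [NormedAddCommGroup E]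
    [InnerProductSpace ℝ E] {b : V → E} {h : V → ℝ} {c s L : ℝ} {m : ℕ} (hm : 0 < m)
    (hb : ∀ S : Finset V, #S ≤ m → ‖∑ i ∈ S, b i‖ ≤ L)
    (h0 : ∀ i, 0 ≤ h i) (hc : ∀ i, h i ≤ c) (hs : ∑ i, h i ≤ s) (hc0 : 0 ≤ c) :
    ‖∑ i, h i • b i‖ ≤ (c + s / m) * L := by
  set y := ∑ i, h i • b i with hy
  rcases eq_or_ne y 0 with h | hne
  · have hL : 0 ≤ L := by simpa using hb ∅ (by simp)
    have : 0 ≤ s := (Finset.sum_nonneg fun i _ => h0 i).trans hs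
    rw [h, norm_zero]
    positivity
  have hypos : 0 < ‖y‖ := norm_pos_iff.mpr hne
  -- Pairing with `y` itself reduces to the scalar case; one factor `‖y‖` cancels at the end.
  have h1 := sum_mul_le_of_forall_card_le (v := fun i => inner ℝ (b i) y) (L := L * ‖y‖) hm
    (fun S hS => by
      rw [← sum_inner]
      exact (real_inner_le_norm _ _).trans (mul_le_mul_of_nonneg_right (hb S hS) hypos.le))
    h0 hc hs hc0
  have h2 : ∑ i, h i * inner ℝ (b i) y = ‖y‖ * ‖y‖ := by
    rw [← real_inner_self_eq_norm_mul_norm]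
    nth_rewrite 2 [hy]
    rw [sum_inner]
    simp [real_inner_smul_left]
  rw [h2, ← mul_assoc] at h1
  exact le_of_mul_le_mul_right h1 hypos

end Combinatorics

/-! ### The random walk on small sets -/

section Walk

variable {V : Type*} [Fintype V] [DecidableEq V] {G : SimpleGraph V} [DecidableRel G.Adj]

omit [DecidableEq V] in
theorem walkMatrix_nonneg (i j : V) : 0 ≤ walkMatrix G i j := by
  simp only [walkMatrix, Matrix.of_apply]
  split_ifs <;> positivity

theorem indicatorVec_dotProduct (S : Finset V) (x : V → ℝ) :
    indicatorVec S ⬝ᵥ x = ∑ i ∈ S, x i := by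
  simp [indicatorVec, dotProduct, Finset.sum_ite_mem]

theorem walkMatrix_mulVec_indicatorVec (T : Finset V) (i : V) :
    (walkMatrix G *ᵥ indicatorVec T) i = ∑ j ∈ T, walkMatrix G i j := by
  simp [Matrix.mulVec, dotProduct, indicatorVec, Finset.sum_ite_mem]

theorem walkMatrix_mulVec_indicatorVec_nonneg (T : Finset V) (i : V) :
    0 ≤ (walkMatrix G *ᵥ indicatorVec T) i := by
  rw [walkMatrix_mulVec_indicatorVec]
  exact Finset.sum_nonneg fun j _ => walkMatrix_nonneg i j

omit [DecidableEq V] in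
theorem sum_walkMatrix_row {d : ℕ} (hd : 0 < d) (hG : G.IsRegularOfDegree d) (i : V) :
    ∑ j, walkMatrix G i j = 1 := by
  have : (d : ℝ) ≠ 0 := by positivity
  have h : #{j | G.Adj i j} = d := by
    rw [← hG i, ← SimpleGraph.card_neighborFinset_eq_degree, SimpleGraph.neighborFinset_eq_filter]
  simp [walkMatrix, hG i, ← Finset.sum_filter, h, this]

omit [DecidableEq V] in
theorem walkMatrix_isSymm {d : ℕ} (hG : G.IsRegularOfDegree d) : (walkMatrix G).IsSymm := by
  ext i j
  simp [walkMatrix, hG i, hG j, G.adj_comm]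

theorem walkMatrix_mulVec_indicatorVec_le_one {d : ℕ} (hd : 0 < d) (hG : G.IsRegularOfDegree d)
    (T : Finset V) (i : V) : (walkMatrix G *ᵥ indicatorVec T) i ≤ 1 := by
  rw [walkMatrix_mulVec_indicatorVec, ← sum_walkMatrix_row hd hG i]
  exact Finset.sum_le_univ_sum_of_nonneg fun j => walkMatrix_nonneg i j

theorem sum_walkMatrix_mulVec_indicatorVec {d : ℕ} (hd : 0 < d) (hG : G.IsRegularOfDegree d)
    (T : Finset V) : ∑ i, (walkMatrix G *ᵥ indicatorVec T) i = #T := by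
  rw [Finset.sum_congr rfl fun i _ => walkMatrix_mulVec_indicatorVec T i]
  refine Finset.sum_comm.trans ?_
  have : ∀ j ∈ T, ∑ i, walkMatrix G i j = 1 := by
    intro j _
    rw [← sum_walkMatrix_row hd hG j]
    exact Finset.sum_congr rfl fun i _ => (walkMatrix_isSymm hG).apply j i
  rw [Finset.sum_congr rfl this]
  simp

/-- Small sets carry few edges in a small-set expander. -/
theorem sum_walkMatrix_self_le {ε δ : ℝ} (hΦ : 1 - ε ≤ expansionProfileLE G δ) {S : Finset V}
    (hS : (#S : ℝ) ≤ δ * Fintype.card V) :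
    ∑ i ∈ S, (walkMatrix G *ᵥ indicatorVec S) i ≤ ε * #S := by
  rcases S.eq_empty_or_nonempty with rfl | hne
  · simp
  have hbdd : BddBelow {x : ℝ | ∃ S : Finset V, S.Nonempty ∧
      (#S : ℝ) ≤ δ * (Fintype.card V : ℝ) ∧ x = expansion G S} := by
    refine (Set.Finite.subset (Set.finite_range (expansion G)) ?_).bddBelow
    rintro x ⟨S, -, -, rfl⟩
    exact ⟨S, rfl⟩
  have h := hΦ.trans (csInf_le hbdd ⟨S, hne, hS, rfl⟩)
  have hpos : (0 : ℝ) < #S := by exact_mod_cast hne.card_pos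
  rw [expansion, indicatorVec_dotProduct] at h
  have h2 : 1 / (#S : ℝ) * ∑ i ∈ S, (walkMatrix G *ᵥ indicatorVec S) i ≤ ε := by linarith
  rwa [one_div, inv_mul_le_iff₀ hpos, mul_comm] at h2

theorem sum_walkMatrix_le_of_card_add_card_le {ε δ : ℝ} (hε : 0 ≤ ε)
    (hΦ : 1 - ε ≤ expansionProfileLE G δ) {S T : Finset V}
    (hST : (#S + #T : ℝ) ≤ δ * Fintype.card V) :
    ∑ i ∈ S, ∑ j ∈ T, walkMatrix G i j ≤ ε * (#S + #T) := by
  have hcard : (#(S ∪ T) : ℝ) ≤ #S + #T := by exact_mod_cast Finset.card_union_le S T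
  have h := sum_walkMatrix_self_le hΦ (hcard.trans hST)
  simp_rw [walkMatrix_mulVec_indicatorVec] at h
  refine le_trans ?_ (h.trans (mul_le_mul_of_nonneg_left hcard hε))
  calc _ ≤ ∑ i ∈ S, ∑ j ∈ S ∪ T, walkMatrix G i j :=
        Finset.sum_le_sum fun i _ => Finset.sum_le_sum_of_subset_of_nonneg
          Finset.subset_union_right fun j _ _ => walkMatrix_nonneg i j
    _ ≤ _ := Finset.sum_le_sum_of_subset_of_nonneg Finset.subset_union_left
          fun i _ _ => Finset.sum_nonneg fun j _ => walkMatrix_nonneg i j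

/-- In a small-set expander few edges leave a small set towards any set that is not much larger. -/
theorem sum_walkMatrix_le {ε δ : ℝ} (hε : 0 ≤ ε) (hδ : 2 ≤ δ * Fintype.card V)
    (hΦ : 1 - ε ≤ expansionProfileLE G δ) (S : Finset V) {T : Finset V}
    (hT : (#T : ℝ) ≤ δ * Fintype.card V) :
    ∑ i ∈ S, (walkMatrix G *ᵥ indicatorVec T) i ≤ ε * (9 * #S + #T) := by
  set k := δ * (Fintype.card V : ℝ)
  -- Two sets of size at most `m` have a union of size at most `k`, so expansion applies to it. The
  -- bound is then extended by chunking, first in `S` and then in `T`.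
  set m := ⌊k / 2⌋₊
  have hm : 0 < m := Nat.floor_pos.mpr (by linarith)
  have hm1 : (1 : ℝ) ≤ m := by exact_mod_cast hm
  have hmk : (m : ℝ) ≤ k / 2 := Nat.floor_le (by linarith)
  have hkm : k / 2 < m + 1 := Nat.lt_floor_add_one _
  have h1 : ∀ T : Finset V, #T ≤ m → ∀ S : Finset V,
      ∑ i ∈ S, ∑ j ∈ T, walkMatrix G i j ≤ ε * #S + ε * #T * (#S / m + 1) := by
    intro T hTm S
    refine sum_le_of_forall_card_le (F := fun i => ∑ j ∈ T, walkMatrix G i j) hm (by positivity)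
      (fun S hSm => ?_) S
    have hTm' : (#T : ℝ) ≤ m := by exact_mod_cast hTm
    have hSm' : (#S : ℝ) ≤ m := by exact_mod_cast hSm
    rw [← mul_add]
    exact sum_walkMatrix_le_of_card_add_card_le hε hΦ (by linarith)
  have h2 := sum_le_of_forall_card_le (F := fun j => ∑ i ∈ S, walkMatrix G i j)
    (α := ε * (#S / m + 1)) (β := ε * #S) hm (by positivity) (fun T hTm => by
      rw [Finset.sum_comm]
      have := h1 T hTm S
      linarith) T
  rw [Finset.sum_comm] at h2
  simp_rw [walkMatrix_mulVec_indicatorVec]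
  refine h2.trans ?_
  -- From `k / 2 < m + 1 ≤ 2m`.
  have h3 : (#T : ℝ) / m ≤ 4 := by
    rw [div_le_iff₀ (by linarith)]; linarith
  have h4 : (#S : ℝ) * (#T / m) ≤ #S * 4 := by gcongr
  calc _ = ε * (#S + #T + 2 * (#S * (#T / m))) := by ring
    _ ≤ _ := mul_le_mul_of_nonneg_left (by linarith) hε

end Walk

/-! ### The high eigenspace and the embedding -/

section Spectral

variable {V : Type*} [Fintype V] [DecidableEq V] {G : SimpleGraph V} [DecidableRel G.Adj]

theorem isSymmetric_toEuclideanLin_walkMatrix {d : ℕ} (hG : G.IsRegularOfDegree d) :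
    (Matrix.toEuclideanLin (walkMatrix G)).IsSymmetric := by
  rw [Matrix.isSymmetric_toEuclideanLin_iff, Matrix.IsHermitian,
    Matrix.conjTranspose_eq_transpose_of_trivial]
  exact walkMatrix_isSymm hG

theorem toEuclideanLin_mem_highEigenspace {y : EuclideanSpace ℝ V} (hy : y ∈ highEigenspace G) :
    Matrix.toEuclideanLin (walkMatrix G) y ∈ highEigenspace G := by
  refine Submodule.span_induction (fun v hv => ?_) (by simp) (fun x y _ _ hx hy => ?_)
    (fun c x _ hx => ?_) hy
  · obtain ⟨μ, -, hv'⟩ := id hv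
    rw [hv'.apply_eq_smul]
    exact Submodule.smul_mem _ _ (Submodule.subset_span hv)
  · rw [map_add]; exact add_mem hx hy
  · rw [map_smul]; exact Submodule.smul_mem _ _ hx

/-- In an orthonormal eigenbasis, the coordinates of `y` with eigenvalue below 1/2 vanish by
orthogonality of eigenspaces, and the others are scaled by at least 1/2. -/
theorem norm_le_two_mul_of_mem_highEigenspace {d : ℕ} (hG : G.IsRegularOfDegree d)
    {y : EuclideanSpace ℝ V} (hy : y ∈ highEigenspace G) :
    ‖y‖ ≤ 2 * ‖Matrix.toEuclideanLin (walkMatrix G) y‖ := by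
  have hsym := isSymmetric_toEuclideanLin_walkMatrix hG
  have hn : Module.finrank ℝ (EuclideanSpace ℝ V) = Fintype.card V := finrank_euclideanSpace
  set e := hsym.eigenvectorBasis hn
  set l := hsym.eigenvalues hn
  have he : ∀ i, Matrix.toEuclideanLin (walkMatrix G) (e i) = l i • e i :=
    fun i => hsym.apply_eigenvectorBasis hn i
  have hzero : ∀ i, l i < 1 / 2 → inner ℝ (e i) y = 0 := by
    intro i hi
    refine Submodule.span_induction (fun v hv => ?_) (by simp) (fun x y _ _ hx hy => ?_)
      (fun c x _ hx => ?_) hy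
    · obtain ⟨μ, hμ, hv'⟩ := hv
      have h := hsym (e i) v
      rw [he i, hv'.apply_eq_smul, real_inner_smul_left, real_inner_smul_right] at h
      have : (l i - μ) * inner ℝ (e i) v = 0 := by linarith
      rcases mul_eq_zero.mp this with h' | h'
      · linarith
      · exact h'
    · rw [inner_add_right, hx, hy, add_zero]
    · rw [real_inner_smul_right, hx, mul_zero]
  have hsq : ‖y‖ ^ 2 ≤ (2 * ‖Matrix.toEuclideanLin (walkMatrix G) y‖) ^ 2 := by
    rw [mul_pow, ← e.sum_sq_norm_inner_right y,
      ← e.sum_sq_norm_inner_right (Matrix.toEuclideanLin (walkMatrix G) y), Finset.mul_sum]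
    refine Finset.sum_le_sum fun i _ => ?_
    rw [← hsym, he, real_inner_smul_left, norm_mul, mul_pow, ← mul_assoc]
    rcases lt_or_ge (l i) (1 / 2) with hi | hi
    · rw [hzero i hi]; simp
    · refine le_mul_of_one_le_left (sq_nonneg _) ?_
      rw [Real.norm_eq_abs, sq_abs]
      nlinarith
  exact le_of_sq_le_sq hsq (by positivity)

theorem starProjection_toEuclideanLin_walkMatrix {d : ℕ} (hG : G.IsRegularOfDegree d)
    (x : EuclideanSpace ℝ V) :
    (highEigenspace G).starProjection (Matrix.toEuclideanLin (walkMatrix G) x) =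
      Matrix.toEuclideanLin (walkMatrix G) ((highEigenspace G).starProjection x) := by
  refine Submodule.eq_starProjection_of_mem_of_inner_eq_zero
    (toEuclideanLin_mem_highEigenspace (Submodule.starProjection_apply_mem _ _)) fun w hw => ?_
  rw [← map_sub, isSymmetric_toEuclideanLin_walkMatrix hG]
  exact Submodule.starProjection_inner_eq_zero _ _ (toEuclideanLin_mem_highEigenspace hw)

theorem norm_starProjection_le_two_mul {d : ℕ} (hG : G.IsRegularOfDegree d)
    (x : EuclideanSpace ℝ V) :
    ‖(highEigenspace G).starProjection x‖ ≤
      2 * ‖(highEigenspace G).starProjection (Matrix.toEuclideanLin (walkMatrix G) x)‖ := by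
  rw [starProjection_toEuclideanLin_walkMatrix hG]
  exact norm_le_two_mul_of_mem_highEigenspace hG (Submodule.starProjection_apply_mem _ _)

/-- `‖Aᵀx‖² = ⟨x, A Aᵀ x⟩ = ⟨x, Π x⟩ = ‖Π x‖²`, whichever factor `A` is chosen. -/
theorem norm_sum_smul_embedding {r : ℕ} {b : V → EuclideanSpace ℝ (Fin r)}
    (hb : IsIsotropicSpectralEmbedding G b) (x : V → ℝ) :
    ‖∑ i, x i • b i‖ =
      √(Fintype.card V) * ‖(highEigenspace G).starProjection (WithLp.toLp 2 x)‖ := by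
  obtain ⟨A, hA, hb⟩ := hb
  have h1 : ∑ i, x i • b i = √(Fintype.card V : ℝ) • WithLp.toLp 2 (Aᵀ *ᵥ x) := by
    ext j
    simp [hb, Matrix.mulVec, dotProduct, Finset.mul_sum]
    exact Finset.sum_congr rfl fun i _ => by ring
  rw [h1, norm_smul, Real.norm_of_nonneg (Real.sqrt_nonneg _)]
  congr 1
  have h2 : ‖WithLp.toLp 2 (Aᵀ *ᵥ x)‖ ^ 2 =
      ‖(highEigenspace G).starProjection (WithLp.toLp 2 x)‖ ^ 2 := by
    rw [EuclideanSpace.real_norm_sq_eq]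
    have h3 : (highEigenspace G).starProjection (WithLp.toLp 2 x) =
        WithLp.toLp 2 ((A * Aᵀ) *ᵥ x) := by
      rw [hA, highProjection, ← Matrix.toEuclideanCLM_toLp]
      simp
    have h4 : ‖(highEigenspace G).starProjection (WithLp.toLp 2 x)‖ ^ 2 =
        inner ℝ ((highEigenspace G).starProjection (WithLp.toLp 2 x)) (WithLp.toLp 2 x) := by
      rw [← real_inner_self_eq_norm_sq, ← Submodule.inner_starProjection_left_eq_right,
        Submodule.starProjection_eq_self_iff.mpr (Submodule.starProjection_apply_mem _ _)]
    rw [h4, h3, EuclideanSpace.inner_toLp_toLp, star_trivial, ← Matrix.mulVec_mulVec,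
      Matrix.dotProduct_mulVec, Matrix.mulVec_transpose]
    simp [dotProduct, sq]
  exact (sq_eq_sq₀ (norm_nonneg _) (norm_nonneg _)).mp h2

end Spectral

/-! ### Spreading, self-improvement and the decay bound -/

section Decay

/-- The numerical estimates that fix the range of `ε`. -/
theorem rpow_bounds {ε a : ℝ} (hε : 0 < ε) (hε0 : ε < Real.exp (-40))
    (ha : a = 20 / Real.log (1 / ε)) :
    0 ≤ a ∧ a ≤ 1 / 2 ∧ (ε ^ (3 / 10 : ℝ)) ^ a ≤ 1 / 64 ∧ 20 * ε / ε ^ (3 / 10 : ℝ) ≤ 1 / 256 ∧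
      (20 * ε / ε ^ (3 / 10 : ℝ)) ^ (1 - a) ≤ 1 / 16 := by
  obtain ⟨l, rfl⟩ : ∃ l, ε = Real.exp (-l) := ⟨-Real.log ε, by rw [neg_neg, Real.exp_log hε]⟩
  have hl40 : 40 < l := by
    rw [Real.exp_lt_exp] at hε0
    linarith
  have hl0 : 0 < l := by linarith
  rw [one_div, Real.log_inv, Real.log_exp, neg_neg] at ha
  have ha0 : 0 ≤ a := by
    rw [ha]
    positivity
  have ha2 : a ≤ 1 / 2 := by
    rw [ha, div_le_iff₀ hl0]
    linarith
  have hal : a * l = 20 := by rw [ha, div_mul_cancel₀ _ hl0.ne']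
  clear ha
  have hηa : (Real.exp (-l) ^ (3 / 10 : ℝ)) ^ a ≤ 1 / 64 := by
    have h1 : (Real.exp (-l) ^ (3 / 10 : ℝ)) ^ a = Real.exp (-6) := by
      rw [← Real.exp_mul, ← Real.exp_mul]
      congr 1
      linarith
    rw [h1, show (-6 : ℝ) = ((6 : ℕ) : ℝ) * (-1) by norm_num, Real.exp_nat_mul]
    have h2 : Real.exp (-1) ≤ 1 / 2 := by linarith [Real.exp_neg_one_lt_half]
    calc Real.exp (-1) ^ 6 ≤ (1 / 2) ^ 6 := pow_le_pow_left₀ (Real.exp_nonneg _) h2 6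
      _ = _ := by norm_num
  have hεη : 20 * Real.exp (-l) / Real.exp (-l) ^ (3 / 10 : ℝ) ≤ 1 / 256 := by
    have h1 : Real.exp (-l) / Real.exp (-l) ^ (3 / 10 : ℝ) ≤ Real.exp (-20) := by
      rw [← Real.exp_mul, ← Real.exp_sub, Real.exp_le_exp]
      linarith
    have h2 : Real.exp (-20) ≤ (1 / 2) ^ 20 := by
      rw [show (-20 : ℝ) = ((20 : ℕ) : ℝ) * (-1) by norm_num, Real.exp_nat_mul]
      exact pow_le_pow_left₀ (Real.exp_nonneg _) (by linarith [Real.exp_neg_one_lt_half]) 20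
    rw [mul_div_assoc]
    norm_num at h2
    linarith
  have hεη0 : 0 < 20 * Real.exp (-l) / Real.exp (-l) ^ (3 / 10 : ℝ) := by positivity
  have hpow : (20 * Real.exp (-l) / Real.exp (-l) ^ (3 / 10 : ℝ)) ^ (1 - a) ≤ 1 / 16 := by
    calc (20 * Real.exp (-l) / Real.exp (-l) ^ (3 / 10 : ℝ)) ^ (1 - a)
        ≤ (20 * Real.exp (-l) / Real.exp (-l) ^ (3 / 10 : ℝ)) ^ (1 / 2 : ℝ) :=
          Real.rpow_le_rpow_of_exponent_ge hεη0 (by linarith) (by linarith)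
      _ = √(20 * Real.exp (-l) / Real.exp (-l) ^ (3 / 10 : ℝ)) := (Real.sqrt_eq_rpow _).symm
      _ ≤ √(1 / 256) := Real.sqrt_le_sqrt hεη
      _ = 1 / 16 := by
          rw [show (1 / 256 : ℝ) = (1 / 16) ^ 2 by norm_num, Real.sqrt_sq (by norm_num)]
  exact ⟨ha0, ha2, hηa, hεη, hpow⟩

variable {V : Type*} [Fintype V] [DecidableEq V] {G : SimpleGraph V} [DecidableRel G.Adj]
  {d : ℕ} {ε δ : ℝ}

/-- One step of the walk spreads out the indicator of a small set: the mass at points of large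
value is small. -/
theorem sum_walkMatrix_mulVec_high_le (hd : 0 < d) (hG : G.IsRegularOfDegree d) (hε : 0 ≤ ε)
    (hδ : 2 ≤ δ * Fintype.card V) (hΦ : 1 - ε ≤ expansionProfileLE G δ) {T : Finset V}
    (hT : (#T : ℝ) ≤ δ * Fintype.card V) {θ : ℝ} (hθ : 0 < θ) (hθ1 : θ ≤ 1) :
    ∑ i with θ < (walkMatrix G *ᵥ indicatorVec T) i, (walkMatrix G *ᵥ indicatorVec T) i ≤
      10 * ε * #T / θ := by
  set g := walkMatrix G *ᵥ indicatorVec T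
  set S := Finset.univ.filter fun i => θ < g i
  have h1 : (#S : ℝ) * θ ≤ #T := by
    calc (#S : ℝ) * θ = ∑ i ∈ S, θ := by simp
      _ ≤ ∑ i ∈ S, g i := Finset.sum_le_sum fun i hi => (Finset.mem_filter.mp hi).2.le
      _ ≤ ∑ i, g i := Finset.sum_le_univ_sum_of_nonneg (walkMatrix_mulVec_indicatorVec_nonneg T)
      _ = #T := sum_walkMatrix_mulVec_indicatorVec hd hG T
  have h2 : (#S : ℝ) ≤ #T / θ := (le_div_iff₀ hθ).mpr h1
  have h3 : (#T : ℝ) ≤ #T / θ := le_div_self (by positivity) hθ hθ1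
  calc _ ≤ ε * (9 * #S + #T) := sum_walkMatrix_le hε hδ hΦ S hT
    _ ≤ ε * (9 * (#T / θ) + #T / θ) := by gcongr
    _ = _ := by ring

/-- Cutting at height `θ` bounds the sum by `θ |T|` plus the high mass `10 ε |T| / θ`, since `g ≤
1`; `θ = √ε` balances the two. -/
theorem sum_sq_walkMatrix_mulVec_le (hd : 0 < d) (hG : G.IsRegularOfDegree d) (hε : 0 < ε)
    (hε1 : ε ≤ 1) (hδ : 2 ≤ δ * Fintype.card V) (hΦ : 1 - ε ≤ expansionProfileLE G δ)
    {T : Finset V} (hT : (#T : ℝ) ≤ δ * Fintype.card V) :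
    ∑ i, (walkMatrix G *ᵥ indicatorVec T) i ^ 2 ≤ 11 * √ε * #T := by
  have hθ : 0 < √ε := Real.sqrt_pos.mpr hε
  have hhigh := sum_walkMatrix_mulVec_high_le hd hG hε.le hδ hΦ hT hθ (Real.sqrt_le_one.mpr hε1)
  have hsum := sum_walkMatrix_mulVec_indicatorVec hd hG T
  have hnn := walkMatrix_mulVec_indicatorVec_nonneg (G := G) T
  have hle := walkMatrix_mulVec_indicatorVec_le_one hd hG T
  set g := walkMatrix G *ᵥ indicatorVec T
  rw [Finset.sum_filter] at hhigh
  have hdiv : 10 * ε * #T / √ε = 10 * √ε * #T := by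
    rw [mul_right_comm, mul_div_assoc, Real.div_sqrt]
    ring
  calc ∑ i, g i ^ 2 ≤ ∑ i, (√ε * g i + if √ε < g i then g i else 0) := by
        refine Finset.sum_le_sum fun i _ => ?_
        have h0 := hnn i
        have h1 := hle i
        split_ifs with h
        · nlinarith
        · nlinarith
    _ ≤ √ε * #T + 10 * √ε * #T := by
        rw [Finset.sum_add_distrib, ← Finset.mul_sum, hsum]
        linarith
    _ = _ := by ring

variable {r : ℕ} {b : V → EuclideanSpace ℝ (Fin r)}

theorem norm_sum_smul_le_two_mul (hG : G.IsRegularOfDegree d)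
    (hb : IsIsotropicSpectralEmbedding G b) (x : V → ℝ) :
    ‖∑ i, x i • b i‖ ≤ 2 * ‖∑ i, (walkMatrix G *ᵥ x) i • b i‖ := by
  rw [norm_sum_smul_embedding hb, norm_sum_smul_embedding hb, mul_left_comm]
  exact mul_le_mul_of_nonneg_left (norm_starProjection_le_two_mul hG _) (Real.sqrt_nonneg _)

theorem norm_sum_smul_sq_le (hb : IsIsotropicSpectralEmbedding G b) (x : V → ℝ) :
    ‖∑ i, x i • b i‖ ^ 2 ≤ Fintype.card V * ∑ i, x i ^ 2 := by
  rw [norm_sum_smul_embedding hb, mul_pow, Real.sq_sqrt (Nat.cast_nonneg _)]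
  gcongr
  refine (pow_le_pow_left₀ (norm_nonneg _)
    (Submodule.norm_starProjection_apply_le _ _) 2).trans_eq ?_
  rw [EuclideanSpace.real_norm_sq_eq]

theorem sum_indicatorVec_smul (T : Finset V) :
    ∑ i, indicatorVec T i • b i = ∑ i ∈ T, b i := by
  simp [indicatorVec, Finset.sum_ite_mem]

theorem norm_sum_le_two_mul (hG : G.IsRegularOfDegree d)
    (hb : IsIsotropicSpectralEmbedding G b) (T : Finset V) :
    ‖∑ i ∈ T, b i‖ ≤ 2 * ‖∑ i, (walkMatrix G *ᵥ indicatorVec T) i • b i‖ := by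
  rw [← sum_indicatorVec_smul]
  exact norm_sum_smul_le_two_mul hG hb _

theorem norm_sum_sq_le (hd : 0 < d) (hG : G.IsRegularOfDegree d) (hε : 0 < ε)
    (hε1 : ε ≤ 1) (hδ : 2 ≤ δ * Fintype.card V) (hΦ : 1 - ε ≤ expansionProfileLE G δ)
    (hb : IsIsotropicSpectralEmbedding G b) {T : Finset V}
    (hT : (#T : ℝ) ≤ δ * Fintype.card V) :
    ‖∑ i ∈ T, b i‖ ^ 2 ≤ 44 * Fintype.card V * √ε * #T := by
  have h1 := pow_le_pow_left₀ (norm_nonneg _) (norm_sum_le_two_mul hG hb T) 2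
  have h2 := norm_sum_smul_sq_le hb (walkMatrix G *ᵥ indicatorVec T)
  have h3 := mul_le_mul_of_nonneg_left (sum_sq_walkMatrix_mulVec_le hd hG hε hε1 hδ hΦ hT)
    (Nat.cast_nonneg (α := ℝ) (Fintype.card V))
  rw [mul_pow] at h1
  linarith

/-- A weight bounded by `η` of mass `t`, where `t ≤ ηk`, behaves like a multiple of the indicator
of a set of `t / η` elements. -/
theorem norm_sum_smul_le_of_le {k M a η : ℝ} {t : ℕ} {h : V → ℝ} (hM : 0 ≤ M) (ha : a ≤ 1)
    (hη : 0 < η) (hη1 : η ≤ 1) (ht : 0 < t) (htk : t ≤ η * k)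
    (hb : ∀ S : Finset V, (#S : ℝ) ≤ k → ‖∑ i ∈ S, b i‖ ≤ M * (#S : ℝ) ^ (1 - a))
    (h0 : ∀ i, 0 ≤ h i) (hc : ∀ i, h i ≤ η) (hs : ∑ i, h i ≤ t) :
    ‖∑ i, h i • b i‖ ≤ 3 * η ^ a * (M * (t : ℝ) ^ (1 - a)) := by
  have ht1 : (1 : ℝ) ≤ t := by exact_mod_cast ht
  have htη : 1 ≤ t / η := by rw [le_div_iff₀ hη]; linarith
  set m := ⌊t / η⌋₊
  have hm : 0 < m := Nat.floor_pos.mpr htη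
  have hm1 : (1 : ℝ) ≤ m := by exact_mod_cast hm
  have hmle : (m : ℝ) ≤ t / η := Nat.floor_le (by linarith)
  have hmlt : t / η < m + 1 := Nat.lt_floor_add_one _
  have hmk : (m : ℝ) ≤ k := hmle.trans (by rw [div_le_iff₀ hη]; linarith)
  have h1 := norm_sum_smul_le_of_forall_card_le (b := b) (L := M * (t / η) ^ (1 - a)) hm
    (fun S hS => by
      have hS' : (#S : ℝ) ≤ m := by exact_mod_cast hS
      refine (hb S (hS'.trans hmk)).trans ?_
      gcongr
      exact hS'.trans hmle) h0 hc hs hη.le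
  have h2 : (t : ℝ) / m ≤ 2 * η := by
    rw [div_le_iff₀ (by linarith)]
    have : (t : ℝ) / η ≤ 2 * m := by linarith
    rw [div_le_iff₀ hη] at this
    linarith
  refine h1.trans ?_
  calc _ ≤ (η + 2 * η) * (M * (t / η) ^ (1 - a)) := by gcongr
    _ = 3 * (η / η ^ (1 - a)) * (M * (t : ℝ) ^ (1 - a)) := by
        rw [Real.div_rpow (by positivity) hη.le]
        ring
    _ = _ := by
        have : η / η ^ (1 - a) = η ^ a := by
          rw [div_eq_iff (by positivity), ← Real.rpow_add hη]
          simp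
        rw [this]

/-- A weight bounded by `1` of mass `s` behaves like the indicator of a set of `s` elements. -/
theorem norm_sum_smul_le_of_le_one {k M a s : ℝ} {t : ℕ} {h : V → ℝ} (hM : 0 ≤ M) (ha0 : 0 ≤ a)
    (ha : a ≤ 1) (hs0 : 0 < s) (hst : s ≤ t) (htk : t ≤ k)
    (hb : ∀ S : Finset V, (#S : ℝ) ≤ k → ‖∑ i ∈ S, b i‖ ≤ M * (#S : ℝ) ^ (1 - a))
    (h0 : ∀ i, 0 ≤ h i) (hc : ∀ i, h i ≤ 1) (hs : ∑ i, h i ≤ s) :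
    ‖∑ i, h i • b i‖ ≤ 2 * (M * (2 * s) ^ (1 - a)) := by
  set m := ⌈s⌉₊
  have hm : 0 < m := Nat.ceil_pos.mpr hs0
  have hm1 : (1 : ℝ) ≤ m := by exact_mod_cast hm
  have hsm : s ≤ m := Nat.le_ceil s
  have hmlt : (m : ℝ) < s + 1 := Nat.ceil_lt_add_one hs0.le
  have hmk : (m : ℝ) ≤ k := le_trans (by exact_mod_cast Nat.ceil_le.mpr hst) htk
  have h1 := norm_sum_smul_le_of_forall_card_le (b := b) (c := min 1 s)
    -- For `s < 1` the ceiling `m` is 1, and the cap 1 would lose the smallness of `s`; each value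
    -- is also at most the total mass, hence the cap `min 1 s`.
    (L := M * (m : ℝ) ^ (1 - a)) hm
    (fun S hS => by
      have hS' : (#S : ℝ) ≤ m := by exact_mod_cast hS
      refine (hb S (hS'.trans hmk)).trans ?_
      gcongr) h0
    (fun i => le_min (hc i)
      ((Finset.single_le_sum (fun j _ => h0 j) (Finset.mem_univ i)).trans hs)) hs
    (le_min zero_le_one hs0.le)
  refine h1.trans ?_
  rcases le_or_gt 1 s with hs1 | hs1
  · have h2 : s / m ≤ 1 := div_le_one_of_le₀ hsm (by linarith)
    have h3 : min 1 s + s / m ≤ 2 := by linarith [min_le_left 1 s]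
    have h4 : (m : ℝ) ^ (1 - a) ≤ (2 * s) ^ (1 - a) := by
      apply Real.rpow_le_rpow <;> linarith
    gcongr
  · have hmeq : m = 1 := le_antisymm (Nat.ceil_le.mpr (by simpa using hs1.le)) hm
    rw [hmeq, min_eq_right hs1.le, Nat.cast_one, Real.one_rpow, div_one]
    have h2 : s ≤ (2 * s) ^ (1 - a) := by
      calc s = s ^ (1 : ℝ) := (Real.rpow_one s).symm
        _ ≤ s ^ (1 - a) := Real.rpow_le_rpow_of_exponent_ge hs0 hs1.le (by linarith)
        _ ≤ _ := Real.rpow_le_rpow hs0.le (by linarith) (by linarith)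
    nlinarith [mul_le_mul_of_nonneg_left h2 hM]

/-- Self-improvement: a power bound for the embedding sums over all small sets gets better by a
constant factor at sets of at most `ηk` elements. -/
theorem norm_sum_le_of_forall_le (hd : 0 < d) (hG : G.IsRegularOfDegree d) (hε : 0 < ε)
    (hδ : 2 ≤ δ * Fintype.card V) (hΦ : 1 - ε ≤ expansionProfileLE G δ)
    (hb : IsIsotropicSpectralEmbedding G b) {M a η : ℝ} (hM : 0 ≤ M) (ha0 : 0 ≤ a) (ha : a ≤ 1)
    (hη : 0 < η) (hη1 : η ≤ 1) (hεη : 10 * ε / η ≤ 1)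
    (hbM : ∀ S : Finset V, (#S : ℝ) ≤ δ * Fintype.card V →
      ‖∑ i ∈ S, b i‖ ≤ M * (#S : ℝ) ^ (1 - a))
    {T : Finset V} (hTne : T.Nonempty) (hT : (#T : ℝ) ≤ η * (δ * Fintype.card V)) :
    ‖∑ i ∈ T, b i‖ ≤
      (6 * η ^ a + 4 * (20 * ε / η) ^ (1 - a)) * (M * (#T : ℝ) ^ (1 - a)) := by
  have ht : 0 < #T := hTne.card_pos
  have ht' : (0 : ℝ) < #T := by exact_mod_cast ht
  have hTk : (#T : ℝ) ≤ δ * Fintype.card V := hT.trans (mul_le_of_le_one_left (by linarith) hη1)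
  have hhigh := sum_walkMatrix_mulVec_high_le hd hG hε.le hδ hΦ hTk hη hη1
  have hsum := sum_walkMatrix_mulVec_indicatorVec hd hG T
  have hnn := walkMatrix_mulVec_indicatorVec_nonneg (G := G) T
  have hle := walkMatrix_mulVec_indicatorVec_le_one hd hG T
  have h2 := norm_sum_le_two_mul hG hb T
  set g := walkMatrix G *ᵥ indicatorVec T
  rw [Finset.sum_filter] at hhigh
  have hlow : ‖∑ i, (if η < g i then 0 else g i) • b i‖ ≤
      3 * η ^ a * (M * (#T : ℝ) ^ (1 - a)) := by
    refine norm_sum_smul_le_of_le hM ha hη hη1 ht hT hbM (fun i => ?_) (fun i => ?_) ?_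
    · split_ifs
      exacts [le_rfl, hnn i]
    · split_ifs with h
      exacts [hη.le, le_of_not_gt h]
    · rw [← hsum]
      refine Finset.sum_le_sum fun i _ => ?_
      split_ifs
      exacts [hnn i, le_rfl]
  have hhi : ‖∑ i, (if η < g i then g i else 0) • b i‖ ≤
      2 * (M * (2 * (10 * ε * #T / η)) ^ (1 - a)) := by
    refine norm_sum_smul_le_of_le_one hM ha0 ha (by positivity) ?_ hTk hbM (fun i => ?_)
      (fun i => ?_) hhigh
    · rw [mul_div_right_comm]
      exact mul_le_of_le_one_left ht'.le hεη
    · split_ifs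
      exacts [hnn i, le_rfl]
    · split_ifs
      exacts [hle i, zero_le_one]
  have hsplit : ∑ i, g i • b i = ∑ i, (if η < g i then 0 else g i) • b i +
      ∑ i, (if η < g i then g i else 0) • b i := by
    rw [← Finset.sum_add_distrib]
    refine Finset.sum_congr rfl fun i _ => ?_
    split_ifs <;> simp
  have hpow : (2 * (10 * ε * #T / η)) ^ (1 - a) =
      (20 * ε / η) ^ (1 - a) * (#T : ℝ) ^ (1 - a) := by
    rw [← Real.mul_rpow (by positivity) ht'.le]
    congr 1
    ring
  rw [hpow] at hhi
  have htri := norm_add_le (∑ i, (if η < g i then 0 else g i) • b i)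
    (∑ i, (if η < g i then g i else 0) • b i)
  rw [← hsplit] at htri
  linarith

/-- The decay of the averages of the embedding, with explicit constants. -/
theorem norm_sum_le (hd : 0 < d) (hG : G.IsRegularOfDegree d) (hε : 0 < ε)
    (hε0 : ε < Real.exp (-40)) (hδ : 2 ≤ δ * Fintype.card V)
    (hΦ : 1 - ε ≤ expansionProfileLE G δ) (hb : IsIsotropicSpectralEmbedding G b) {a : ℝ}
    (ha : a = 20 / Real.log (1 / ε)) {T : Finset V} (hTne : T.Nonempty)
    (hT : (#T : ℝ) ≤ δ * Fintype.card V) :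
    ‖∑ i ∈ T, b i‖ ≤ 10 * ε ^ (1 / 10 : ℝ) * √(Fintype.card V) *
      (δ * Fintype.card V) ^ (a - 1 / 2) * (#T : ℝ) ^ (1 - a) := by
  set k := δ * (Fintype.card V : ℝ)
  have hk : 0 < k := by linarith
  obtain ⟨ha0, ha2, hηa, hεη, hpow⟩ := rpow_bounds hε hε0 ha
  have hε1 : ε ≤ 1 := hε0.le.trans (Real.exp_le_one_iff.mpr (by norm_num))
  set η := ε ^ (3 / 10 : ℝ) with hη
  have hη0 : 0 < η := Real.rpow_pos_of_pos hε _
  have hη1 : η ≤ 1 := Real.rpow_le_one hε.le hε1 (by norm_num)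
  -- An extremal set replaces an iteration over scales: one self-improvement step at `T₀` is enough.
  obtain ⟨T₀, hT₀, hmax⟩ := Finset.exists_max_image
    (Finset.univ.filter fun S : Finset V => S.Nonempty ∧ (#S : ℝ) ≤ k)
    (fun S => ‖∑ i ∈ S, b i‖ / (#S : ℝ) ^ (1 - a)) ⟨T, by simp [hTne, hT]⟩
  simp only [Finset.mem_filter, Finset.mem_univ, true_and] at hT₀ hmax
  obtain ⟨hne₀, hk₀⟩ := hT₀
  set M := ‖∑ i ∈ T₀, b i‖ / (#T₀ : ℝ) ^ (1 - a) with hMdef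
  have ht₀ : (0 : ℝ) < #T₀ := by exact_mod_cast hne₀.card_pos
  have hM0 : 0 ≤ M := by positivity
  have hbM : ∀ S : Finset V, (#S : ℝ) ≤ k → ‖∑ i ∈ S, b i‖ ≤ M * (#S : ℝ) ^ (1 - a) := by
    intro S hS
    rcases S.eq_empty_or_nonempty with rfl | hne
    · simp only [Finset.sum_empty, norm_zero]
      positivity
    · have : (0 : ℝ) < #S := by exact_mod_cast hne.card_pos
      exact (div_le_iff₀ (by positivity)).mp (hmax S ⟨hne, hS⟩)
  refine (hbM T hT).trans (mul_le_mul_of_nonneg_right ?_ (by positivity))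
  rcases le_or_gt (#T₀ : ℝ) (η * k) with hsmall | hlarge
  -- The factor is at most `6/64 + 4/16 < 1/2`, which contradicts extremality unless `M ≤ 0`.
  · have h1 := norm_sum_le_of_forall_le hd hG hε hδ hΦ hb hM0 ha0 (by linarith) hη0 hη1
      (le_trans (by gcongr; norm_num) (hεη.trans (by norm_num))) hbM hne₀ hsmall
    have h3 : 0 < (#T₀ : ℝ) ^ (1 - a) := by positivity
    have h2 : ‖∑ i ∈ T₀, b i‖ = M * (#T₀ : ℝ) ^ (1 - a) := by
      rw [hMdef, div_mul_cancel₀ _ h3.ne']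
    rw [h2] at h1
    have h4 : M * (#T₀ : ℝ) ^ (1 - a) ≤ 1 / 2 * (M * (#T₀ : ℝ) ^ (1 - a)) :=
      h1.trans (mul_le_mul_of_nonneg_right (by linarith) (mul_nonneg hM0 h3.le))
    have h5 : M ≤ 0 := by
      by_contra! h
      have := mul_pos h h3
      linarith
    exact h5.trans (by positivity)
  · have h1 : ‖∑ i ∈ T₀, b i‖ ≤ 7 * √(Fintype.card V) * ε ^ (1 / 4 : ℝ) * √(#T₀) := by
      refine le_of_sq_le_sq ?_ (by positivity)
      refine (norm_sum_sq_le hd hG hε hε1 hδ hΦ hb hk₀).trans ?_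
      rw [mul_pow, mul_pow, mul_pow, Real.sq_sqrt (by positivity), Real.sq_sqrt (by positivity),
        ← Real.rpow_natCast (ε ^ _), ← Real.rpow_mul hε.le, Real.sqrt_eq_rpow]
      norm_num
      gcongr
      norm_num
    -- The two powers use opposite bounds on the size: `#T₀ ≤ k` for the exponent `a`, `#T₀ > ηk`
    -- for `-1/2`. Keeping them apart avoids a factor `η^a`.
    have h2 : (#T₀ : ℝ) ^ (a - 1 / 2) ≤ k ^ a * (η * k) ^ (-(1 / 2) : ℝ) := by
      rw [sub_eq_add_neg, Real.rpow_add ht₀]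
      have h3 : (#T₀ : ℝ) ^ a ≤ k ^ a := Real.rpow_le_rpow ht₀.le hk₀ ha0
      have h4 : (#T₀ : ℝ) ^ (-(1 / 2) : ℝ) ≤ (η * k) ^ (-(1 / 2) : ℝ) :=
        Real.rpow_le_rpow_of_nonpos (by positivity) hlarge.le (by norm_num)
      gcongr
    have h3 : k ^ a * (η * k) ^ (-(1 / 2) : ℝ) = ε ^ (-(3 / 20) : ℝ) * k ^ (a - 1 / 2) := by
      rw [Real.mul_rpow hη0.le hk.le, hη, ← Real.rpow_mul hε.le, mul_left_comm,
        ← Real.rpow_add hk]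
      norm_num [sub_eq_add_neg]
    have h4 : √(#T₀ : ℝ) = (#T₀ : ℝ) ^ (a - 1 / 2) * (#T₀ : ℝ) ^ (1 - a) := by
      rw [← Real.rpow_add ht₀, Real.sqrt_eq_rpow]
      congr 1
      ring
    have h5 : ε ^ (1 / 4 : ℝ) * ε ^ (-(3 / 20) : ℝ) = ε ^ (1 / 10 : ℝ) := by
      rw [← Real.rpow_add hε]
      norm_num
    rw [hMdef, div_le_iff₀ (by positivity)]
    refine h1.trans ?_
    rw [h4, ← mul_assoc]
    refine mul_le_mul_of_nonneg_right ?_ (by positivity)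
    calc _ ≤ 7 * √(Fintype.card V) * ε ^ (1 / 4 : ℝ) *
          (ε ^ (-(3 / 20) : ℝ) * k ^ (a - 1 / 2)) := by
          rw [h3] at h2
          gcongr
      _ = 7 * ε ^ (1 / 10 : ℝ) * √(Fintype.card V) * k ^ (a - 1 / 2) := by
          rw [← h5]
          ring
      _ ≤ _ := by gcongr; norm_num

end Decay

end SpectralEmbedding

end

theorem mainTheorem5 :
    ∃ ε₀ C C' : ℝ, 0 < ε₀ ∧ 0 < C ∧ 0 < C' ∧
      ∀ (n d : ℕ) (G : SimpleGraph (Fin n)) [DecidableRel G.Adj],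
        0 < d → G.IsRegularOfDegree d →
      ∀ (ε δ : ℝ), 0 < ε → ε < ε₀ → 2 ≤ δ * (n : ℝ) →
        1 - ε ≤ SpectralEmbedding.expansionProfileLE G δ →
      ∀ (r : ℕ) (b : Fin n → EuclideanSpace ℝ (Fin r)),
        SpectralEmbedding.IsIsotropicSpectralEmbedding G b →
      ∀ T : Finset (Fin n), T.Nonempty → (T.card : ℝ) ≤ δ * (n : ℝ) →
        ‖(1 / (T.card : ℝ)) • ∑ i ∈ T, b i‖ ≤
          C' * Real.exp (C * (Real.log (δ * (n : ℝ) / (T.card : ℝ)) / Real.log (1 / ε))) *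
            (ε ^ (1 / 10 : ℝ) / Real.sqrt δ) := by
  refine ⟨Real.exp (-40), 20, 10, Real.exp_pos _, by norm_num, by norm_num, ?_⟩
  intro n d G _ hd hG ε δ hε hε0 hδ hΦ r b hb T hTne hT
  have hcard : (Fintype.card (Fin n) : ℝ) = n := by simp
  have h := SpectralEmbedding.norm_sum_le (δ := δ) hd hG hε hε0 (by rwa [hcard]) hΦ hb rfl hTne
    (by rwa [hcard])
  rw [hcard] at h
  set a := 20 / Real.log (1 / ε) with ha
  have ht : (0 : ℝ) < T.card := by exact_mod_cast hTne.card_pos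
  have hk : 0 < δ * (n : ℝ) := by linarith
  have hn : (0 : ℝ) < n := by
    refine (Nat.cast_nonneg n).lt_of_ne fun h0 => ?_
    rw [← h0, mul_zero] at hk
    exact hk.false
  have hδ0 : 0 < δ := pos_of_mul_pos_left hk hn.le
  -- The exponential factor is `(δn / |T|)^a`, so `C` is the 20 in the definition of `a`.
  have hexp : Real.exp (20 * (Real.log (δ * n / T.card) / Real.log (1 / ε))) =
      (δ * n) ^ a / (T.card : ℝ) ^ a := by
    rw [← Real.div_rpow hk.le ht.le, Real.rpow_def_of_pos (by positivity), ha]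
    congr 1
    ring
  have hsqrt : √(n : ℝ) * (δ * n) ^ (a - 1 / 2) = (δ * n) ^ a / √δ := by
    rw [Real.rpow_sub hk, ← Real.sqrt_eq_rpow, Real.sqrt_mul hδ0.le]
    have : 0 < √(n : ℝ) := Real.sqrt_pos.mpr hn
    field_simp
  have htpow : (T.card : ℝ) ^ (1 - a) = T.card / (T.card : ℝ) ^ a := by
    rw [Real.rpow_sub ht, Real.rpow_one]
  rw [norm_smul, Real.norm_of_nonneg (by positivity), one_div_mul_eq_div, div_le_iff₀ ht, hexp]
  refine h.trans_eq ?_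
  rw [mul_assoc _ (√(n : ℝ)), hsqrt, htpow]
  ring
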